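/- Work in the Hilbert space $L^2(\mathbb{R},\mathbb{C})$ with inner product $\langle f,g\rangle=\int_{\mathbb{R}}\overline{f(x)}\,g(x)\,dx$. Let $Xf(x)=xf(x)$ and $Pf(x)=-if'(x)$ on the Schwartz class $\mathcal{S}$, let $\tfrac12(X^2+P^2)$ be the resulting operator with domain $\mathcal{S}$, and let $\Phi(x)=\pi^{-1/4}e^{-x^2/2}$ be the vacuum vector. A resolution of the identity is a family $\{E_\lambda\}_{\lambda\in\mathbb{R}}$ of orthogonal projections with $E_\lambda E_\mu=E_{\min(\lambda,\mu)}$, strongly right-continuous, with strong limits $0$ as $\lambda\to-\infty$ and $\mathbf 1$ as $\lambda\to+\infty$. It is the spectral resolution of an operator $T$ if $T=\int\lambda\,dE_\lambda$, that is, $\mathrm{dom}(T)=\{f:\int_{\mathbb{R}}\lambda^2\,d\langle f,E_\lambda f\rangle<\infty\}$ and $\langle f,Tf\rangle=\int_{\mathbb{R}}\lambda\,d\langle f,E_\lambda f\rangle$ for all $f\in\mathrm{dom}(T)$. The family $\{e^{itT}\}_{t\in\mathbb{R}}$ is the strongly continuous one-parameter unitary group with infinitesimal generator $iT$. **Theorem.**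 The operator $\tfrac12(X^2+P^2)$ on $\mathcal{S}$ has a self-adjoint extension. Every self-adjoint extension $T$ of it has a spectral resolution $\{E_\lambda\}$ and generates a unitary group $\{e^{itT}\}$, and any such $\{E_\lambda\}$ and $\{e^{itT}\}$ satisfy the following. The vacuum spectral resolution is the Heaviside step at $1/2$: $$\langle\Phi,E_\lambda\Phi\rangle=H_{1/2}(\lambda)=\begin{cases}1,&\lambda\ge\tfrac12,\\0,&\lambda<\tfrac12,\end{cases}\qquad\lambda\in\mathbb{R}.$$ Moreover, for all $t\in\mathbb{R}$, the vacuum characteristic function is $$\langle\Phi,e^{itT}\Phi\rangle=\int_{\mathbb{R}}e^{it\lambda}\,d\langle\Phi,E_\lambda\Phi\rangle=e^{it/2},$$ and the vacuum distribution of $T$, i.e. the measure $d\langle\Phi,E_\lambda\Phi\rangle$ on $\mathbb{R}$, is the point mass $\delta_{1/2}$. -/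

import Mathlib

open MeasureTheory Filter Topology
open scoped InnerProductSpace SchwartzMap

noncomputable section

namespace HarmonicOscillator

/-! ### Resolutions of the identity and unitary groups on a Hilbert space -/

section Hilbert

variable {H : Type*} [NormedAddCommGroup H] [InnerProductSpace ℂ H] [CompleteSpace H]

variable (H) in
/-- A resolution of the identity `{E_r | r ∈ ℝ}` on a Hilbert space: an increasing family of
orthogonal projections (`E_r E_s = E_{min r s}`), strongly continuous from the right, with strong
limits `0` at `-∞` and `1` at `+∞`. Thus `E_r` plays the role of `E((-∞, r])`. -/
structure ResolutionOfIdentity where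
  proj : ℝ → H →L[ℂ] H
  isStarProjection : ∀ r, IsStarProjection (proj r)
  proj_mul_proj : ∀ r s, proj r * proj s = proj (min r s)
  right_continuous : ∀ (f : H) (r : ℝ), ContinuousWithinAt (fun s => proj s f) (Set.Ici r) r
  tendsto_atBot : ∀ f : H, Tendsto (fun r => proj r f) atBot (𝓝 0)
  tendsto_atTop : ∀ f : H, Tendsto (fun r => proj r f) atTop (𝓝 f)

namespace ResolutionOfIdentity

variable (E : ResolutionOfIdentity H)

theorem inner_proj (f : H) (r : ℝ) :
    ⟪f, E.proj r f⟫_ℂ = ((‖E.proj r f‖ ^ 2 : ℝ) : ℂ) := by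
  have h1 : E.proj r (E.proj r f) = E.proj r f :=
    congrArg (fun A : H →L[ℂ] H => A f) (E.isStarProjection r).isIdempotentElem.eq
  have h2 := (E.isStarProjection r).isSelfAdjoint
  rw [ContinuousLinearMap.isSelfAdjoint_iff_isSymmetric] at h2
  calc ⟪f, E.proj r f⟫_ℂ = ⟪f, E.proj r (E.proj r f)⟫_ℂ := by rw [h1]
    _ = ⟪E.proj r f, E.proj r f⟫_ℂ := (h2 f (E.proj r f)).symm
    _ = _ := by rw [inner_self_eq_norm_sq_to_K]; push_cast; rfl

/-- The nondecreasing right-continuous function `r ↦ ⟨f, E_r f⟩`. -/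
def distribution (f : H) : StieltjesFunction ℝ where
  toFun r := (⟪f, E.proj r f⟫_ℂ).re
  mono' := by
    intro r s hrs
    have hmul : E.proj r f = E.proj r (E.proj s f) := by
      have := congrArg (fun A : H →L[ℂ] H => A f) (E.proj_mul_proj r s)
      simpa [min_eq_left hrs] using this.symm
    have hle : ‖E.proj r f‖ ≤ ‖E.proj s f‖ := by
      rw [hmul]
      exact ((E.proj r).le_opNorm _).trans
        (mul_le_of_le_one_left (norm_nonneg _) (E.isStarProjection r).norm_le)
    simp only [inner_proj, Complex.ofReal_re]
    gcongr
  right_continuous' r :=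
    Complex.continuous_re.continuousAt.comp_continuousWithinAt
      (ContinuousWithinAt.inner (𝕜 := ℂ) continuousWithinAt_const (E.right_continuous f r))

/-- The Lebesgue-Stieltjes measure `d⟨f, E_r f⟩` on the real line: the distribution of the
observable with spectral resolution `E` in the (vector) state `f`. -/
def measure (f : H) : Measure ℝ := (E.distribution f).measure

/-- `E` is the spectral resolution of the operator `T`, i.e. `T = ∫ r dE_r`: the domain of `T` is
`{f | ∫ r² d⟨f, E_r f⟩ < ∞}`, and `⟨f, T f⟩ = ∫ r d⟨f, E_r f⟩` for every `f` in the domain. -/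
structure IsSpectralResolution (T : H →ₗ.[ℂ] H) : Prop where
  mem_domain_iff : ∀ f : H, f ∈ T.domain ↔ Integrable (fun r : ℝ => r ^ 2) (E.measure f)
  inner_apply : ∀ f : T.domain, ⟪(f : H), T f⟫_ℂ = ((∫ r, r ∂(E.measure f) : ℝ) : ℂ)

end ResolutionOfIdentity

/-- `U t = e^{itT}` for all real `t`: the family `U` is a strongly continuous one-parameter unitary
group whose infinitesimal generator is `iT`, that is, `t ↦ U t f` is differentiable at `0` with
derivative `i g` exactly when `f` is in the domain of `T` and `T f = g`. -/
structure IsUnitaryExponential (T : H →ₗ.[ℂ] H) (U : ℝ → H →L[ℂ] H) : Prop where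
  mem_unitary : ∀ t, U t ∈ unitary (H →L[ℂ] H)
  map_zero : U 0 = 1
  map_add : ∀ s t, U (s + t) = U s * U t
  continuous : ∀ f : H, Continuous fun t => U t f
  generator : ∀ f g : H, (f, g) ∈ T.graph ↔ HasDerivAt (fun t => U t f) (Complex.I • g) 0

end Hilbert

/-! ### The harmonic oscillator on `L²(ℝ, ℂ)` -/

/-- The Hilbert space `L²(ℝ, ℂ)`. -/
abbrev L2 : Type := Lp ℂ 2 (volume : Measure ℝ)

/-- The position operator on the Schwartz class, `(X f)(x) = x f(x)`. -/
def X : 𝓢(ℝ, ℂ) →ₗ[ℂ] 𝓢(ℝ, ℂ) :=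
  (SchwartzMap.smulLeftCLM ℂ (fun x : ℝ => (x : ℂ))).toLinearMap

theorem X_apply (f : 𝓢(ℝ, ℂ)) (x : ℝ) : X f x = x * f x :=
  SchwartzMap.smulLeftCLM_apply_apply (by fun_prop) f x

/-- The momentum operator on the Schwartz class, `(P f)(x) = -i f'(x)` (with `ħ = 1`). -/
def P : 𝓢(ℝ, ℂ) →ₗ[ℂ] 𝓢(ℝ, ℂ) :=
  -Complex.I • (SchwartzMap.derivCLM ℂ ℂ).toLinearMap

theorem P_apply (f : 𝓢(ℝ, ℂ)) (x : ℝ) : P f x = -Complex.I * deriv f x := rfl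

/-- The embedding of the Schwartz class into `L²(ℝ, ℂ)`. -/
def schwartzEmbedding : 𝓢(ℝ, ℂ) →ₗ[ℂ] L2 :=
  (SchwartzMap.toLpCLM ℂ ℂ 2 (volume : Measure ℝ)).toLinearMap

theorem schwartzEmbedding_injective : Function.Injective schwartzEmbedding :=
  SchwartzMap.injective_toLp 2 (volume : Measure ℝ)

/-- The Hamiltonian `½ (X² + P²)`, as an unbounded operator on `L²(ℝ, ℂ)` with the Schwartz class
as its domain. -/
def hamiltonian : L2 →ₗ.[ℂ] L2 where
  domain := LinearMap.range schwartzEmbedding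
  toFun := schwartzEmbedding ∘ₗ ((1 / 2 : ℂ) • (X ∘ₗ X + P ∘ₗ P)) ∘ₗ
    (LinearEquiv.ofInjective schwartzEmbedding schwartzEmbedding_injective).symm.toLinearMap

/-- The vacuum function `Φ(x) = π^{-1/4} e^{-x²/2}`. -/
def vacuumFun (x : ℝ) : ℂ := ((Real.pi ^ (-(1 / 4) : ℝ) * Real.exp (-(x ^ 2) / 2) : ℝ) : ℂ)

theorem memLp_vacuumFun : MemLp vacuumFun 2 (volume : Measure ℝ) := by
  have hc : Continuous vacuumFun := by unfold vacuumFun; fun_prop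
  rw [memLp_two_iff_integrable_sq_norm hc.aestronglyMeasurable]
  have h := (integrable_exp_neg_mul_sq (b := 1) one_pos).const_mul
    ((Real.pi ^ (-(1 / 4) : ℝ)) ^ 2)
  refine h.congr (ae_of_all _ fun x => ?_)
  simp only [vacuumFun, Complex.norm_real, Real.norm_eq_abs, sq_abs, mul_pow]
  rw [← Real.exp_nat_mul]
  congr 2
  push_cast
  ring

/-- The vacuum vector `Φ` in `L²(ℝ, ℂ)`. -/
def vacuum : L2 := memLp_vacuumFun.toLp vacuumFun

/-- The Heaviside unit step function at `a`. -/
def heaviside (a x : ℝ) : ℝ := if a ≤ x then 1 else 0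

end HarmonicOscillator

end

/-!
The Hermite functions diagonalize `½ (X² + P²)`, and this determines all its self-adjoint
extensions, so that the general spectral theorem for unbounded operators is not needed.

On the Schwartz class, the commutation relation `P_X` shows that the creation operator `X - iP`
raises the eigenvalue of the oscillator by one (`oscillator_creation`). Applied repeatedly to the
vacuum it yields eigenfunctions with eigenvalues `n + 1/2`, which are orthogonal because the
oscillator is symmetric. Their span contains every `x ^ k Φ` (`X_iterate_vacuum_mem_span`). If `u`
is orthogonal to all of these, then all moments of `Φ u` vanish, hence so does its Fourier
transform, and `u = 0` (`eq_zero_of_inner_X_iterate_vacuum`). So the normalized eigenfunctions form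
a Hilbert basis, `hermiteBasis`.

A self-adjoint operator whose domain contains a Hilbert basis of eigenvectors is the maximal
multiplication operator in that basis (`isDiagonal_of_isSelfAdjoint`), and conversely that
multiplication operator is self-adjoint (`exists_isDiagonal`). This gives the self-adjoint
extension, and for any such extension the spectral projections and the unitary group are explicit
multipliers; strong continuity and differentiability are dominated convergence in coordinates
(`tendsto_of_inner_basis`).

For an arbitrary spectral resolution `E` of a self-adjoint `T` and an eigenvector `f` with
eigenvalue `c`, split `f = p + q` with `p = E_c f`. The measure of `f` is the sum of those of `p`
and `q`, and symmetry of `T` makes the cross term `⟪p, T q⟫` vanish. Hence `∫ (r - c)` vanishes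
over `(-∞, c]` as well as over `(c, ∞)`, where the integrand has constant sign, so the measure is
concentrated at `c` (`measure_eq_smul_dirac_of_eigenvector`). For an arbitrary unitary exponential,
`t ↦ U t f` solves a linear differential equation (`IsUnitaryExponential.apply_eigenvector`). The
vacuum is the eigenvector with `c = 1/2`.
-/

noncomputable section

namespace HarmonicOscillator

/-! ### Operators diagonal in a Hilbert basis -/

section Diagonal

variable {H : Type*} [NormedAddCommGroup H] [InnerProductSpace ℂ H]

theorem hasSum_norm_sq_inner (b : HilbertBasis ℕ ℂ H) (f : H) :
    HasSum (fun n => ‖⟪b n, f⟫_ℂ‖ ^ 2) (‖f‖ ^ 2) := by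
  have h := b.hasSum_inner_mul_inner f f
  have h2 := Complex.hasSum_re h
  rw [inner_self_eq_norm_sq_to_K] at h2
  convert h2 using 1
  · ext n
    rw [← inner_conj_symm f (b n), ← Complex.normSq_eq_conj_mul_self, Complex.ofReal_re,
      Complex.normSq_eq_norm_sq]
  · norm_cast

theorem ext_inner_basis (b : HilbertBasis ℕ ℂ H) {f g : H}
    (h : ∀ n, ⟪b n, f⟫_ℂ = ⟪b n, g⟫_ℂ) : f = g := by
  apply b.repr.injective
  ext n
  rw [b.repr_apply_apply, b.repr_apply_apply, h n]

/-- Dominated convergence in coordinates: strong convergence follows from convergence of each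
coordinate together with a summable bound on the squared coordinates of the error. -/
theorem tendsto_of_inner_basis (b : HilbertBasis ℕ ℂ H) {α : Type*} {l : Filter α}
    {F : α → H} {x : H} {c : ℕ → ℝ} (hc : Summable c)
    (hle : ∀ᶠ a in l, ∀ n, ‖⟪b n, F a - x⟫_ℂ‖ ^ 2 ≤ c n)
    (hlim : ∀ n, Tendsto (fun a => ⟪b n, F a⟫_ℂ) l (𝓝 ⟪b n, x⟫_ℂ)) :
    Tendsto F l (𝓝 x) := by
  have h : Tendsto (fun a => ∑' n, ‖⟪b n, F a - x⟫_ℂ‖ ^ 2) l (𝓝 (∑' _ : ℕ, (0 : ℝ))) := by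
    refine tendsto_tsum_of_dominated_convergence hc (fun n => ?_) ?_
    · have := ((hlim n).sub_const ⟪b n, x⟫_ℂ).norm.pow 2
      simpa [inner_sub_right] using this
    · filter_upwards [hle] with a ha n
      simpa using ha n
  simp only [(hasSum_norm_sq_inner b _).tsum_eq, tsum_zero] at h
  rw [tendsto_iff_norm_sub_tendsto_zero]
  have h3 := h.sqrt
  simpa using h3

theorem exists_multiplier (b : HilbertBasis ℕ ℂ H) (φ : ℕ → ℂ) (hφ : ∀ n, ‖φ n‖ ≤ 1) :
    ∃ M : H →L[ℂ] H, ∀ f n, ⟪b n, M f⟫_ℂ = φ n * ⟪b n, f⟫_ℂ := by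
  have hle (f : H) (n : ℕ) : ‖φ n * ⟪b n, f⟫_ℂ‖ ^ 2 ≤ ‖⟪b n, f⟫_ℂ‖ ^ 2 := by
    rw [norm_mul]
    gcongr
    exact mul_le_of_le_one_left (norm_nonneg _) (hφ n)
  have hmem (f : H) : Memℓp (fun n => φ n * ⟪b n, f⟫_ℂ) 2 := by
    apply memℓp_gen
    simpa using Summable.of_nonneg_of_le (fun n => by positivity) (hle f)
      (hasSum_norm_sq_inner b f).summable
  have hco (f : H) (n : ℕ) : ⟪b n, b.repr.symm ⟨_, hmem f⟩⟫_ℂ = φ n * ⟪b n, f⟫_ℂ := by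
    rw [← b.repr_apply_apply, LinearIsometryEquiv.apply_symm_apply]
  refine ⟨LinearMap.mkContinuous
    { toFun := fun f => b.repr.symm ⟨_, hmem f⟩
      map_add' := fun f g => ext_inner_basis b fun n => by
        rw [inner_add_right, hco, hco, hco, inner_add_right, mul_add]
      map_smul' := fun a f => ext_inner_basis b fun n => by
        rw [inner_smul_right, hco, RingHom.id_apply, hco, inner_smul_right, mul_left_comm] }
    1 fun f => ?_, hco⟩
  rw [one_mul]
  refine le_of_sq_le_sq ?_ (norm_nonneg _)
  refine hasSum_le (fun n => ?_) (hasSum_norm_sq_inner b _) (hasSum_norm_sq_inner b f)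
  rw [LinearMap.coe_mk, AddHom.coe_mk, hco]
  exact hle f n

/-- The bounded operator with `b n ↦ φ n • b n`, for a multiplier `φ` bounded by `1`. Both the
spectral projections and the unitary group of a diagonal operator are of this form. -/
def multiplier (b : HilbertBasis ℕ ℂ H) (φ : ℕ → ℂ) (hφ : ∀ n, ‖φ n‖ ≤ 1) : H →L[ℂ] H :=
  (exists_multiplier b φ hφ).choose

theorem inner_multiplier (b : HilbertBasis ℕ ℂ H) (φ : ℕ → ℂ) (hφ : ∀ n, ‖φ n‖ ≤ 1) (f : H)
    (n : ℕ) : ⟪b n, multiplier b φ hφ f⟫_ℂ = φ n * ⟪b n, f⟫_ℂ :=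
  (exists_multiplier b φ hφ).choose_spec f n

theorem adjoint_multiplier [CompleteSpace H] (b : HilbertBasis ℕ ℂ H) (φ : ℕ → ℂ)
    (hφ : ∀ n, ‖φ n‖ ≤ 1) (hφ' : ∀ n, ‖(starRingEnd ℂ) (φ n)‖ ≤ 1) :
    star (multiplier b φ hφ) = multiplier b (fun n => (starRingEnd ℂ) (φ n)) hφ' := by
  ext f
  refine ext_inner_basis b fun n => ?_
  rw [ContinuousLinearMap.star_eq_adjoint, ContinuousLinearMap.adjoint_inner_right,
    ← inner_conj_symm]
  have h : multiplier b φ hφ (b n) = φ n • b n := ext_inner_basis b fun m => by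
    rw [inner_multiplier, inner_smul_right]
    by_cases hmn : m = n
    · rw [hmn]
    · rw [b.orthonormal.inner_eq_zero hmn]; simp
  rw [h, inner_smul_right, map_mul, inner_conj_symm, inner_multiplier]

/-- The operator `T` acts as multiplication by the real numbers `ev n` in the Hilbert basis `b`, on
the maximal domain: `T f = g` as soon as every coordinate of `g` is `ev n` times that of `f`. -/
def IsDiagonal (b : HilbertBasis ℕ ℂ H) (ev : ℕ → ℝ) (T : H →ₗ.[ℂ] H) : Prop :=
  ∀ f g : H, (f, g) ∈ T.graph ↔ ∀ n, ⟪b n, g⟫_ℂ = ev n * ⟪b n, f⟫_ℂ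

theorem inner_eq_of_coordinates (b : HilbertBasis ℕ ℂ H) (ev : ℕ → ℝ) {f g x y : H}
    (h : ∀ n, ⟪b n, g⟫_ℂ = ev n * ⟪b n, f⟫_ℂ) (h' : ∀ n, ⟪b n, y⟫_ℂ = ev n * ⟪b n, x⟫_ℂ) :
    ⟪g, x⟫_ℂ = ⟪f, y⟫_ℂ := by
  rw [← b.tsum_inner_mul_inner, ← b.tsum_inner_mul_inner]
  congr 1 with n
  rw [← inner_conj_symm g, ← inner_conj_symm f, h, h', map_mul, Complex.conj_ofReal]
  ring

theorem dense_of_basis_mem (b : HilbertBasis ℕ ℂ H) (S : Submodule ℂ H) (h : ∀ n, b n ∈ S) :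
    Dense (S : Set H) := by
  rw [Submodule.dense_iff_topologicalClosure_eq_top, eq_top_iff, ← b.dense_span]
  exact Submodule.topologicalClosure_mono (Submodule.span_le.2 (by rintro _ ⟨n, rfl⟩; exact h n))

theorem inner_basis_eigen (b : HilbertBasis ℕ ℂ H) (ev : ℕ → ℝ) (m n : ℕ) :
    ⟪b n, (ev m : ℂ) • b m⟫_ℂ = ev n * ⟪b n, b m⟫_ℂ := by
  rw [inner_smul_right]
  by_cases hmn : n = m
  · rw [hmn]
  · rw [b.orthonormal.inner_eq_zero hmn]; simp

variable [CompleteSpace H]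

/-- A self-adjoint operator with a Hilbert basis of eigenvectors is the maximal multiplication
operator in that basis: the graph of `T` is its own adjoint, and Parseval's identity puts every pair
with the right coordinates into the adjoint graph. -/
theorem isDiagonal_of_isSelfAdjoint (b : HilbertBasis ℕ ℂ H) (ev : ℕ → ℝ) {T : H →ₗ.[ℂ] H}
    (hT : IsSelfAdjoint T) (hb : ∀ n, (b n, (ev n : ℂ) • b n) ∈ T.graph) :
    IsDiagonal b ev T := by
  have hg : T.graph = T.graph.adjoint := by
    rw [← LinearPMap.adjoint_graph_eq_graph_adjoint hT.dense_domain,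
      LinearPMap.isSelfAdjoint_def.1 hT]
  have key : ∀ f g : H, (f, g) ∈ T.graph → ∀ n, ⟪b n, g⟫_ℂ = ev n * ⟪b n, f⟫_ℂ := by
    intro f g h n
    rw [hg, Submodule.mem_adjoint_iff] at h
    have := h _ _ (hb n)
    rw [inner_smul_left, Complex.conj_ofReal] at this
    exact (sub_eq_zero.1 this).symm
  refine fun f g => ⟨key f g, fun h => ?_⟩
  rw [hg, Submodule.mem_adjoint_iff]
  intro x y hxy
  exact sub_eq_zero.2 (inner_eq_of_coordinates b ev (key x y hxy) h)

/-- The multiplication operator on its maximal domain is self-adjoint. -/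
theorem exists_isDiagonal (b : HilbertBasis ℕ ℂ H) (ev : ℕ → ℝ) :
    ∃ T : H →ₗ.[ℂ] H, IsSelfAdjoint T ∧ IsDiagonal b ev T := by
  let G : Submodule ℂ (H × H) :=
    { carrier := {p | ∀ n, ⟪b n, p.2⟫_ℂ = ev n * ⟪b n, p.1⟫_ℂ}
      zero_mem' := by simp
      add_mem' := by
        intro p q hp hq n
        rw [Prod.snd_add, Prod.fst_add, inner_add_right, inner_add_right, hp n, hq n]; ring
      smul_mem' := by
        intro a p hp n
        rw [Prod.smul_snd, Prod.smul_fst, inner_smul_right, inner_smul_right, hp n]; ring }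
  have hG : G.toLinearPMap.graph = G := by
    refine Submodule.toLinearPMap_graph_eq G fun p hp h0 => ext_inner_basis b fun n => ?_
    rw [hp n, h0]; simp
  have hdiag : IsDiagonal b ev G.toLinearPMap := fun f g => by rw [hG]; rfl
  have hb (n : ℕ) : (b n, (ev n : ℂ) • b n) ∈ G := fun m => inner_basis_eigen b ev n m
  have hdense : Dense (G.toLinearPMap.domain : Set H) :=
    dense_of_basis_mem b _ fun n => ⟨_, hb n, rfl⟩
  refine ⟨G.toLinearPMap, ?_, hdiag⟩
  rw [LinearPMap.isSelfAdjoint_def]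
  apply LinearPMap.eq_of_eq_graph
  rw [LinearPMap.adjoint_graph_eq_graph_adjoint hdense, hG]
  ext ⟨x, y⟩
  rw [Submodule.mem_adjoint_iff]
  constructor
  · intro h n
    have := h _ _ (hb n)
    rw [inner_smul_left, Complex.conj_ofReal] at this
    exact (sub_eq_zero.1 this).symm
  · intro h f g hfg
    exact sub_eq_zero.2 (inner_eq_of_coordinates b ev hfg h)

end Diagonal

/-! ### The spectral resolution of a diagonal operator -/

section Resolution

variable {H : Type*} [NormedAddCommGroup H] [InnerProductSpace ℂ H] [CompleteSpace H]

namespace ResolutionOfIdentity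

variable (E : ResolutionOfIdentity H)

theorem distribution_apply (f : H) (r : ℝ) : E.distribution f r = ‖E.proj r f‖ ^ 2 := by
  change (⟪f, E.proj r f⟫_ℂ).re = _
  rw [inner_proj, Complex.ofReal_re]

theorem tendsto_distribution_atBot (f : H) : Tendsto (E.distribution f) atBot (𝓝 0) := by
  have h := ((E.tendsto_atBot f).norm.pow 2)
  simpa [← distribution_apply] using h

theorem tendsto_distribution_atTop (f : H) : Tendsto (E.distribution f) atTop (𝓝 (‖f‖ ^ 2)) := by
  have h := ((E.tendsto_atTop f).norm.pow 2)
  simpa [← distribution_apply] using h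

theorem measure_Iic (f : H) (r : ℝ) :
    E.measure f (Set.Iic r) = ENNReal.ofReal (‖E.proj r f‖ ^ 2) := by
  rw [measure, StieltjesFunction.measure_Iic _ (E.tendsto_distribution_atBot f), sub_zero,
    distribution_apply]

theorem measure_univ (f : H) : E.measure f Set.univ = ENNReal.ofReal (‖f‖ ^ 2) := by
  rw [measure, StieltjesFunction.measure_univ _ (E.tendsto_distribution_atBot f)
    (E.tendsto_distribution_atTop f), sub_zero]

instance isFiniteMeasure (f : H) : IsFiniteMeasure (E.measure f) :=
  ⟨by rw [measure_univ]; exact ENNReal.ofReal_lt_top⟩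

theorem proj_proj (r s : ℝ) (f : H) : E.proj r (E.proj s f) = E.proj (min r s) f :=
  congrArg (fun A : H →L[ℂ] H => A f) (E.proj_mul_proj r s)

end ResolutionOfIdentity

/-- The projections onto the span of the basis vectors with `ev n ≤ r` form a resolution of the
identity. -/
theorem exists_resolution_of_multiplier (b : HilbertBasis ℕ ℂ H) (ev : ℕ → ℝ) :
    ∃ E : ResolutionOfIdentity H,
      ∀ r f n, ⟪b n, E.proj r f⟫_ℂ = (if ev n ≤ r then 1 else 0) * ⟪b n, f⟫_ℂ := by
  have hφ (r : ℝ) (n : ℕ) : ‖(if ev n ≤ r then 1 else 0 : ℂ)‖ ≤ 1 := by split_ifs <;> simp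
  have hlim {l : Filter ℝ} {p : ℝ → H} {f x : H}
      (hp : ∀ r n, ⟪b n, p r⟫_ℂ = (if ev n ≤ r then 1 else 0 : ℂ) * ⟪b n, f⟫_ℂ)
      (hx : ∀ n, (∀ᶠ r in l, ⟪b n, p r⟫_ℂ = ⟪b n, x⟫_ℂ))
      (hx' : ∀ n, ⟪b n, x⟫_ℂ = ⟪b n, f⟫_ℂ ∨ ⟪b n, x⟫_ℂ = 0) : Tendsto p l (𝓝 x) := by
    refine tendsto_of_inner_basis b (hasSum_norm_sq_inner b f).summable
      (Eventually.of_forall fun r n => ?_) fun n => tendsto_nhds_of_eventually_eq (hx n)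
    rw [inner_sub_right, hp]
    gcongr
    rcases hx' n with h | h <;> rw [h] <;> split_ifs <;> simp
  refine ⟨⟨fun r => multiplier b (fun n => if ev n ≤ r then 1 else 0) (hφ r), fun r => ⟨?_, ?_⟩,
    fun r s => ?_, fun f r => ?_, fun f => ?_, fun f => ?_⟩,
    fun r f n => inner_multiplier b _ (hφ r) f n⟩
  · ext f
    refine ext_inner_basis b fun n => ?_
    rw [mul_apply_eq_comp, inner_multiplier, inner_multiplier]
    split_ifs <;> simp
  · rw [isSelfAdjoint_iff, adjoint_multiplier b _ _ (fun n => by split_ifs <;> simp)]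
    congr 1 with n
    split_ifs <;> simp
  · ext f
    refine ext_inner_basis b fun n => ?_
    rw [mul_apply_eq_comp, inner_multiplier, inner_multiplier, inner_multiplier,
      ← mul_assoc]
    congr 1
    simp only [le_min_iff]
    by_cases h1 : ev n ≤ r <;> by_cases h2 : ev n ≤ s <;> simp [h1, h2]
  · refine hlim (fun r n => inner_multiplier b _ _ f n) (fun n => ?_) fun n => ?_
    · rw [inner_multiplier]
      by_cases h : ev n ≤ r
      · filter_upwards [self_mem_nhdsWithin] with s hs
        rw [inner_multiplier, if_pos h, if_pos (h.trans hs)]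
      · filter_upwards [nhdsWithin_le_nhds (Iio_mem_nhds (not_le.1 h))] with s hs
        rw [inner_multiplier, if_neg h, if_neg (not_le.2 hs)]
    · rw [inner_multiplier]
      split_ifs <;> simp
  · refine hlim (fun r n => inner_multiplier b _ _ f n) (fun n => ?_) fun n => by simp
    filter_upwards [eventually_lt_atBot (ev n)] with r hr
    rw [inner_multiplier, if_neg (not_le.2 hr)]; simp
  · refine hlim (fun r n => inner_multiplier b _ _ f n) (fun n => ?_) fun n => by simp
    filter_upwards [eventually_ge_atTop (ev n)] with r hr
    rw [inner_multiplier, if_pos hr]; simp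

/-- For the spectral resolution by multipliers, the distribution in the state `f` puts mass
`|⟪b n, f⟫|²` at each eigenvalue `ev n`. -/
theorem measure_eq_sum_dirac (b : HilbertBasis ℕ ℂ H) (ev : ℕ → ℝ) (E : ResolutionOfIdentity H)
    (hE : ∀ r f n, ⟪b n, E.proj r f⟫_ℂ = (if ev n ≤ r then 1 else 0) * ⟪b n, f⟫_ℂ) (f : H) :
    E.measure f =
      Measure.sum fun n => ENNReal.ofReal (‖⟪b n, f⟫_ℂ‖ ^ 2) • Measure.dirac (ev n) := by
  refine Measure.ext_of_Iic _ _ fun r => ?_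
  have h := hasSum_norm_sq_inner b (E.proj r f)
  rw [E.measure_Iic, Measure.sum_apply _ measurableSet_Iic, ← h.tsum_eq,
    ENNReal.ofReal_tsum_of_nonneg (fun n => by positivity) h.summable]
  congr 1 with n
  rw [hE, Measure.smul_apply, Measure.dirac_apply' _ measurableSet_Iic, smul_eq_mul]
  by_cases hn : ev n ≤ r <;> simp [hn]

theorem exists_isSpectralResolution_of_isDiagonal {b : HilbertBasis ℕ ℂ H} {ev : ℕ → ℝ}
    {T : H →ₗ.[ℂ] H} (hT : IsDiagonal b ev T) :
    ∃ E : ResolutionOfIdentity H, E.IsSpectralResolution T := by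
  obtain ⟨E, hE⟩ := exists_resolution_of_multiplier b ev
  have hfin (f : H) (n : ℕ) : ENNReal.ofReal (‖⟪b n, f⟫_ℂ‖ ^ 2) ≠ ⊤ := ENNReal.ofReal_ne_top
  refine ⟨E, fun f => ?_, fun f => ?_⟩
  · have hint : Integrable (fun r : ℝ => r ^ 2) (E.measure f) ↔
        Summable fun n => ‖(ev n : ℂ) * ⟪b n, f⟫_ℂ‖ ^ 2 := by
      rw [measure_eq_sum_dirac b ev E hE, integrable_sum_dirac_iff (hfin f)]
      refine summable_congr fun n => ?_
      rw [ENNReal.toReal_ofReal (by positivity), norm_mul, mul_pow, Complex.norm_real, norm_pow,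
        mul_comm]
    rw [hint, LinearPMap.mem_domain_iff]
    constructor
    · rintro ⟨g, hg⟩
      refine (hasSum_norm_sq_inner b g).summable.congr fun n => ?_
      rw [(hT f g).1 hg n]
    · intro h
      refine ⟨b.repr.symm ⟨fun n => (ev n : ℂ) * ⟪b n, f⟫_ℂ, memℓp_gen (by simpa using h)⟩,
        (hT _ _).2 fun n => ?_⟩
      rw [← b.repr_apply_apply, LinearIsometryEquiv.apply_symm_apply]
  · have h1 := (hT f (T f)).1 (T.mem_graph f)
    rw [measure_eq_sum_dirac b ev E hE, integral_sum_dirac (hfin f), Complex.ofReal_tsum,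
      ← b.tsum_inner_mul_inner]
    congr 1 with n
    rw [h1, ENNReal.toReal_ofReal (by positivity), ← inner_conj_symm (f : H), mul_left_comm,
      Complex.conj_mul', smul_eq_mul]
    push_cast
    ring

end Resolution

/-! ### The unitary group of a diagonal operator -/

section UnitaryGroup

variable {H : Type*} [NormedAddCommGroup H] [InnerProductSpace ℂ H] [CompleteSpace H]

theorem exists_isUnitaryExponential_of_isDiagonal {b : HilbertBasis ℕ ℂ H} {ev : ℕ → ℝ}
    {T : H →ₗ.[ℂ] H} (hT : IsDiagonal b ev T) :
    ∃ U : ℝ → H →L[ℂ] H, IsUnitaryExponential T U := by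
  have hnorm (t : ℝ) (n : ℕ) : ‖Complex.exp (Complex.I * (t * ev n : ℝ))‖ = 1 := by
    rw [Complex.norm_exp_I_mul_ofReal]
  have hnorm' (t : ℝ) (n : ℕ) :
      ‖(starRingEnd ℂ) (Complex.exp (Complex.I * (t * ev n : ℝ)))‖ ≤ 1 := by
    rw [RCLike.norm_conj, hnorm]
  let U (t : ℝ) : H →L[ℂ] H :=
    multiplier b (fun n => Complex.exp (Complex.I * (t * ev n : ℝ))) fun n => (hnorm t n).le
  have hU (t : ℝ) (f : H) (n : ℕ) :
      ⟪b n, U t f⟫_ℂ = Complex.exp (Complex.I * (t * ev n : ℝ)) * ⟪b n, f⟫_ℂ :=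
    inner_multiplier b _ _ f n
  have hU0 : U 0 = 1 := by
    ext f
    exact ext_inner_basis b fun n => by rw [hU]; simp
  have hconj (t : ℝ) (n : ℕ) : (starRingEnd ℂ) (Complex.exp (Complex.I * (t * ev n : ℝ))) *
      Complex.exp (Complex.I * (t * ev n : ℝ)) = 1 := by
    rw [Complex.conj_mul', hnorm]; simp
  have hderiv (f : H) (n : ℕ) : HasDerivAt (fun t : ℝ => ⟪b n, U t f⟫_ℂ)
      (Complex.I * (ev n * ⟪b n, f⟫_ℂ)) 0 := by
    simp only [hU]
    have h1 : HasDerivAt (fun t : ℝ => Complex.I * ((t * ev n : ℝ) : ℂ)) (Complex.I * ev n) 0 := by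
      refine HasDerivAt.const_mul _ ?_
      simpa using ((hasDerivAt_id (0 : ℝ)).mul_const (ev n)).ofReal_comp
    have h2 := h1.cexp.mul_const ⟪b n, f⟫_ℂ
    simpa [mul_assoc] using h2
  refine ⟨U, fun t => ?_, hU0, fun s t => ?_, fun f => ?_, fun f g => ⟨fun h => ?_, fun h => ?_⟩⟩
  · rw [Unitary.mem_iff]
    simp only [U]
    rw [adjoint_multiplier b _ _ (hnorm' t)]
    constructor
    all_goals
      ext f
      refine ext_inner_basis b fun n => ?_
      rw [mul_apply_eq_comp, inner_multiplier, inner_multiplier, ← mul_assoc]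
    · rw [hconj]; simp
    · rw [mul_comm (Complex.exp _), hconj]; simp
  · ext f
    refine ext_inner_basis b fun n => ?_
    rw [mul_apply_eq_comp, hU, hU, hU, ← mul_assoc, ← Complex.exp_add]
    push_cast
    ring_nf
  · rw [continuous_iff_continuousAt]
    intro t
    refine tendsto_of_inner_basis b (c := fun n => 4 * ‖⟪b n, f⟫_ℂ‖ ^ 2)
      ((hasSum_norm_sq_inner b f).summable.mul_left 4) (Eventually.of_forall fun s n => ?_)
      fun n => ?_
    · rw [inner_sub_right, hU, hU, ← sub_mul, norm_mul, mul_pow]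
      gcongr
      have h := norm_sub_le (Complex.exp (Complex.I * (s * ev n : ℝ)))
        (Complex.exp (Complex.I * (t * ev n : ℝ)))
      rw [hnorm, hnorm] at h
      nlinarith [norm_nonneg (Complex.exp (Complex.I * (s * ev n : ℝ)) -
        Complex.exp (Complex.I * (t * ev n : ℝ)))]
    · simp only [hU]
      apply ContinuousAt.tendsto
      fun_prop
  · have hg := (hT f g).1 h
    rw [hasDerivAt_iff_tendsto_slope]
    refine tendsto_of_inner_basis b (c := fun n => 4 * ‖⟪b n, g⟫_ℂ‖ ^ 2)
      ((hasSum_norm_sq_inner b g).summable.mul_left 4) ?_ fun n => ?_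
    · filter_upwards [self_mem_nhdsWithin] with t ht n
      have ht : 0 < |t| := abs_pos.2 ht
      -- `|exp (i t x) - 1| ≤ |t x|` bounds the difference quotient by the limit
      have h1 : ‖⟪b n, slope (fun t => U t f) 0 t⟫_ℂ‖ ≤ ‖⟪b n, g⟫_ℂ‖ := by
        rw [slope_def_module, sub_zero, hU0, inner_smul_right_eq_smul, norm_smul, inner_sub_right,
          hU, hg, one_apply_eq_self, ← sub_one_mul, norm_mul, norm_mul, norm_inv,
          Real.norm_eq_abs, Complex.norm_real]
        have h2 := Real.norm_exp_I_mul_ofReal_sub_one_le (x := t * ev n)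
        rw [norm_mul, Real.norm_eq_abs] at h2
        rw [← mul_assoc]
        gcongr
        rwa [inv_mul_le_iff₀ ht]
      have h2 := norm_sub_le ⟪b n, slope (fun t => U t f) 0 t⟫_ℂ ⟪b n, Complex.I • g⟫_ℂ
      have h3 : ‖⟪b n, Complex.I • g⟫_ℂ‖ = ‖⟪b n, g⟫_ℂ‖ := by
        rw [inner_smul_right, norm_mul, Complex.norm_I, one_mul]
      rw [← inner_sub_right, h3] at h2
      nlinarith [norm_nonneg ⟪b n, slope (fun t => U t f) 0 t - Complex.I • g⟫_ℂ]
    · have h1 := (hderiv f n).tendsto_slope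
      rw [inner_smul_right, hg]
      refine h1.congr fun t => ?_
      rw [slope_def_module, slope_def_module, inner_smul_right_eq_smul, inner_sub_right]
  · rw [hT]
    intro n
    have h1 : HasDerivAt (fun t : ℝ => ⟪b n, U t f⟫_ℂ) ⟪b n, Complex.I • g⟫_ℂ 0 :=
      ((innerSL ℂ (b n)).restrictScalars ℝ).hasFDerivAt.comp_hasDerivAt 0 h
    have h2 := h1.unique (hderiv f n)
    rw [inner_smul_right] at h2
    exact mul_left_cancel₀ Complex.I_ne_zero h2

/-- On an eigenvector the unitary group acts by the phase `exp (i t c)`: the group law turns the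
derivative at `0` into a linear differential equation for `t ↦ U t f`. -/
theorem IsUnitaryExponential.apply_eigenvector {T : H →ₗ.[ℂ] H} {U : ℝ → H →L[ℂ] H}
    (hU : IsUnitaryExponential T U) {f : H} {c : ℝ} (hf : (f, (c : ℂ) • f) ∈ T.graph) (t : ℝ) :
    U t f = Complex.exp (Complex.I * t * c) • f := by
  have h0 : HasDerivAt (fun s => U s f) ((Complex.I * c) • f) 0 := by
    have := (hU.generator _ _).1 hf
    rwa [smul_smul] at this
  have hd (s : ℝ) : HasDerivAt (fun s => U s f) ((Complex.I * c) • U s f) s := by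
    have h0' : HasDerivAt (fun s => U s f) ((Complex.I * c) • f) (s - s) := by rwa [sub_self]
    have h1 := h0'.comp_sub_const s s
    have h2 := ((U s).restrictScalars ℝ).hasFDerivAt.comp_hasDerivAt s h1
    have h3 : (((U s).restrictScalars ℝ) ∘ fun x => U (x - s) f) = fun s => U s f := by
      ext x
      have := congrArg (fun A : H →L[ℂ] H => A f) (hU.map_add s (x - s))
      simpa using this.symm
    rw [h3] at h2
    simpa using h2
  have he (s : ℝ) : HasDerivAt (fun s : ℝ => Complex.exp (-(Complex.I * c) * s))
      (Complex.exp (-(Complex.I * c) * s) * -(Complex.I * c)) s := by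
    have h1 : HasDerivAt (fun s : ℝ => -(Complex.I * c) * (s : ℂ)) (-(Complex.I * c)) s := by
      simpa using (hasDerivAt_id s).ofReal_comp.const_mul (-(Complex.I * c))
    exact h1.cexp
  have hconst (s : ℝ) :
      HasDerivAt (fun s : ℝ => Complex.exp (-(Complex.I * c) * s) • U s f) 0 s := by
    refine ((he s).smul (hd s)).congr_deriv ?_
    rw [smul_smul, ← add_smul]
    simp
  have h := is_const_of_deriv_eq_zero (fun s => (hconst s).differentiableAt)
    (fun s => (hconst s).deriv) t 0
  simp only [hU.map_zero, Complex.ofReal_zero, mul_zero, Complex.exp_zero, one_smul,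
    one_apply_eq_self] at h
  calc U t f = Complex.exp (Complex.I * t * c) • (Complex.exp (-(Complex.I * c) * t) • U t f) := by
        rw [smul_smul, ← Complex.exp_add]
        ring_nf
        simp
    _ = _ := by rw [h]

end UnitaryGroup

/-! ### The distribution of an observable in an eigenstate -/

section Eigenvector

variable {H : Type*} [NormedAddCommGroup H] [InnerProductSpace ℂ H] [CompleteSpace H]

theorem inner_proj_apply_self (E : ResolutionOfIdentity H) (f : H) (r : ℝ) :
    ⟪E.proj r f, f⟫_ℂ = ((‖E.proj r f‖ ^ 2 : ℝ) : ℂ) := by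
  rw [← inner_conj_symm, E.inner_proj, Complex.conj_ofReal]

theorem norm_sq_proj_add_norm_sq_sub (E : ResolutionOfIdentity H) (f : H) (r : ℝ) :
    ‖E.proj r f‖ ^ 2 + ‖f - E.proj r f‖ ^ 2 = ‖f‖ ^ 2 := by
  rw [@norm_sub_sq ℂ, E.inner_proj, RCLike.re_to_complex, Complex.ofReal_re]
  ring

/-- Projecting a state with `E_r` cuts off its distribution above `r`. -/
theorem measure_proj (E : ResolutionOfIdentity H) (f : H) (r : ℝ) :
    E.measure (E.proj r f) = (E.measure f).restrict (Set.Iic r) := by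
  refine Measure.ext_of_Iic _ _ fun s => ?_
  rw [Measure.restrict_apply measurableSet_Iic, Set.Iic_inter_Iic, E.measure_Iic, E.measure_Iic,
    E.proj_proj]

theorem measure_proj_add_measure_sub (E : ResolutionOfIdentity H) (f : H) (r : ℝ) :
    E.measure (E.proj r f) + E.measure (f - E.proj r f) = E.measure f := by
  refine Measure.ext_of_Iic _ _ fun s => ?_
  rw [Measure.add_apply, E.measure_Iic, E.measure_Iic, E.measure_Iic,
    ← ENNReal.ofReal_add (by positivity) (by positivity), map_sub, E.proj_proj s r, min_comm,
    ← E.proj_proj r s, norm_sq_proj_add_norm_sq_sub]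

/-- In an eigenstate, the distribution of the observable is concentrated at the eigenvalue. The
hypothesis on `E` controls only the diagonal elements `⟪f, T f⟫`, so that neither the commutation of
`E` with `T` nor the formula for `‖T f‖²` is available beforehand. -/
theorem measure_eq_smul_dirac_of_eigenvector {E : ResolutionOfIdentity H} {T : H →ₗ.[ℂ] H}
    (hT : IsSelfAdjoint T) (hE : E.IsSpectralResolution T) {f : H} {c : ℝ}
    (hf : (f, (c : ℂ) • f) ∈ T.graph) :
    E.measure f = ENNReal.ofReal (‖f‖ ^ 2) • Measure.dirac c := by
  set p := E.proj c f with hp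
  set q := f - p with hq
  set μ := E.measure f with hμ
  have hadd : E.measure p + E.measure q = μ := measure_proj_add_measure_sub E f c
  have hfd : f ∈ T.domain := LinearPMap.mem_domain_of_mem_graph hf
  have hTf : T ⟨f, hfd⟩ = (c : ℂ) • f :=
    T.mem_graph_snd_inj (T.mem_graph ⟨f, hfd⟩) hf rfl
  have hsq : Integrable (fun r : ℝ => r ^ 2) μ := (hE.mem_domain_iff f).1 hfd
  have hpd : p ∈ T.domain := (hE.mem_domain_iff p).2 <| hsq.mono_measure <| by
    rw [← hadd]; exact Measure.le_add_right le_rfl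
  have hqd : q ∈ T.domain := T.domain.sub_mem hfd hpd
  have hx : Integrable (fun r : ℝ => r) μ := by
    refine (hsq.add (integrable_const (1 : ℝ))).mono' (by fun_prop) (ae_of_all _ fun r => ?_)
    rw [Pi.add_apply, Real.norm_eq_abs, abs_le]
    constructor <;> nlinarith [sq_nonneg (r - 1), sq_nonneg (r + 1)]
  have hA := hE.inner_apply ⟨p, hpd⟩
  have hB := hE.inner_apply ⟨q, hqd⟩
  have hC := hE.inner_apply ⟨f, hfd⟩
  have hint : ∫ r, r ∂(E.measure p) + ∫ r, r ∂(E.measure q) = ∫ r, r ∂μ := by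
    rw [← hadd, integral_add_measure] <;> refine hx.mono_measure ?_ <;> rw [← hadd]
    · exact Measure.le_add_right le_rfl
    · exact Measure.le_add_left le_rfl
  have hsum : T ⟨p, hpd⟩ + T ⟨q, hqd⟩ = (c : ℂ) • f := by
    rw [← hTf, ← T.map_add]
    congr 1
    ext
    simp [hq]
  have hsymm : ⟪T ⟨p, hpd⟩, q⟫_ℂ = ⟪p, T ⟨q, hqd⟩⟫_ℂ := by
    have h := LinearPMap.adjoint_isFormalAdjoint hT.dense_domain
    rw [LinearPMap.isSelfAdjoint_def.1 hT] at h
    exact h ⟨p, hpd⟩ ⟨q, hqd⟩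
  -- The cross terms `⟪p, T q⟫` and `⟪q, T p⟫` are real and conjugate, and they add up to `0`.
  have hpf : ⟪p, T ⟨p, hpd⟩⟫_ℂ + ⟪p, T ⟨q, hqd⟩⟫_ℂ = c * ((‖p‖ ^ 2 : ℝ) : ℂ) := by
    rw [← inner_add_right, hsum, inner_smul_right, inner_proj_apply_self]
  have hqf : ⟪q, T ⟨p, hpd⟩⟫_ℂ + ⟪q, T ⟨q, hqd⟩⟫_ℂ = c * ((‖q‖ ^ 2 : ℝ) : ℂ) := by
    rw [← inner_add_right, hsum, inner_smul_right]
    congr 1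
    rw [eq_sub_of_add_eq' (norm_sq_proj_add_norm_sq_sub E f c), hq,
      inner_sub_left, inner_proj_apply_self, inner_self_eq_norm_sq_to_K]
    push_cast
    rfl
  have hff : ⟪f, T ⟨f, hfd⟩⟫_ℂ = c * ((‖f‖ ^ 2 : ℝ) : ℂ) := by
    rw [hTf, inner_smul_right, inner_self_eq_norm_sq_to_K]
    push_cast
    rfl
  simp only at hA hB hC
  rw [← inner_conj_symm q, hsymm] at hqf
  have hpyth := norm_sq_proj_add_norm_sq_sub E f c
  rw [hff] at hC
  rw [hA] at hpf
  rw [hB] at hqf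
  have hpf' := congrArg Complex.re hpf
  have hqf' := congrArg Complex.re hqf
  have hC' : c * ‖f‖ ^ 2 = ∫ r, r ∂μ := by exact_mod_cast hC
  simp only [Complex.add_re, Complex.ofReal_re, Complex.re_ofReal_mul, Complex.conj_re]
    at hpf' hqf'
  have hmom : ∫ r in Set.Iic c, r ∂μ = c * ‖p‖ ^ 2 := by
    rw [hμ, ← measure_proj, ← hp]
    linear_combination (hpf' - hqf' + hint - hC' - c * hpyth) / 2
  have hIic : μ.real (Set.Iic c) = ‖p‖ ^ 2 := by
    rw [Measure.real, hμ, E.measure_Iic, ENNReal.toReal_ofReal (by positivity)]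
  have huniv : μ.real Set.univ = ‖f‖ ^ 2 := by
    rw [Measure.real, hμ, E.measure_univ, ENNReal.toReal_ofReal (by positivity)]
  have hc : Integrable (fun _ : ℝ => c) μ := integrable_const c
  have hxc : Integrable (fun r => r - c) μ := hx.sub hc
  have hcx : Integrable (fun r => c - r) μ := hc.sub hx
  -- `c - r` integrates to `0` over `(-∞, c]` and over `ℝ`, so `|r - c|` integrates to `0`.
  have h1 : ∫ r in Set.Iic c, (c - r) ∂μ = 0 := by
    rw [integral_sub hc.integrableOn hx.integrableOn, hmom, setIntegral_const, hIic, smul_eq_mul]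
    ring
  have h2 : ∫ r, (r - c) ∂μ = 0 := by
    rw [integral_sub hx hc, integral_const, huniv, smul_eq_mul, ← hC']
    ring
  have habs : ∫ r, |r - c| ∂μ = 0 := by
    have h3 : ∀ r, |r - c| = (r - c) + 2 * (Set.Iic c).indicator (fun r => c - r) r := by
      intro r
      by_cases hr : r ≤ c
      · rw [Set.indicator_of_mem (Set.mem_Iic.2 hr), abs_of_nonpos (by linarith)]
        ring
      · rw [Set.indicator_of_notMem (by simpa using hr), abs_of_pos (by linarith)]
        ring
    simp only [h3]
    rw [integral_add hxc ((hcx.indicator measurableSet_Iic).const_mul 2),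
      integral_const_mul, integral_indicator measurableSet_Iic, h1, h2]
    ring
  have hae : (fun r : ℝ => r) =ᵐ[μ] fun _ => c := by
    rw [integral_eq_zero_iff_of_nonneg (fun r => abs_nonneg _) hxc.abs] at habs
    filter_upwards [habs] with r hr
    exact sub_eq_zero.1 (abs_eq_zero.1 hr)
  calc μ = μ.map fun r => r := Measure.map_id'.symm
    _ = μ.map fun _ => c := Measure.map_congr hae
    _ = _ := by rw [Measure.map_const, hμ, E.measure_univ]

end Eigenvector

/-! ### Creation and annihilation operators on the Schwartz class -/

section Schwartz

open Polynomial in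
theorem exists_bound_polynomial_mul_gaussian (q : ℂ[X]) :
    ∃ C : ℝ, ∀ x : ℝ, ‖q.eval (x : ℂ)‖ * Real.exp (-(x ^ 2) / 2) ≤ C := by
  induction q using Polynomial.induction_on' with
  | add p q hp hq =>
    obtain ⟨C, hC⟩ := hp
    obtain ⟨D, hD⟩ := hq
    refine ⟨C + D, fun x => ?_⟩
    rw [eval_add]
    calc _ ≤ (‖p.eval (x : ℂ)‖ + ‖q.eval (x : ℂ)‖) * Real.exp (-(x ^ 2) / 2) := by
          gcongr
          exact norm_add_le _ _
      _ ≤ C + D := by rw [add_mul]; exact add_le_add (hC x) (hD x)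
  | monomial n a =>
    refine ⟨‖a‖ * (n.factorial * Real.exp (1 / 2)), fun x => ?_⟩
    rw [eval_monomial, norm_mul, norm_pow, Complex.norm_real, Real.norm_eq_abs, mul_assoc]
    refine mul_le_mul_of_nonneg_left ?_ (norm_nonneg a)
    have h1 := Real.pow_div_factorial_le_exp |x| (abs_nonneg x) n
    rw [div_le_iff₀' (by positivity)] at h1
    calc |x| ^ n * Real.exp (-(x ^ 2) / 2)
        ≤ n.factorial * Real.exp |x| * Real.exp (-(x ^ 2) / 2) := by gcongr
      _ = n.factorial * Real.exp (|x| + -(x ^ 2) / 2) := by rw [mul_assoc, ← Real.exp_add]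
      _ ≤ n.factorial * Real.exp (1 / 2) := by
          gcongr
          nlinarith [sq_nonneg (|x| - 1), sq_abs x]

theorem hasDerivAt_vacuumFun (x : ℝ) : HasDerivAt vacuumFun (-x * vacuumFun x) x := by
  unfold vacuumFun
  have h : HasDerivAt (fun x : ℝ => Real.pi ^ (-(1 / 4) : ℝ) * Real.exp (-(x ^ 2) / 2))
      (Real.pi ^ (-(1 / 4) : ℝ) * (Real.exp (-(x ^ 2) / 2) * -x)) x := by
    refine (HasDerivAt.exp ?_).const_mul _
    refine (((hasDerivAt_pow 2 x).neg).div_const 2).congr_deriv ?_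
    simp
    ring
  refine h.ofReal_comp.congr_deriv ?_
  push_cast
  ring

open Polynomial in
theorem exists_iteratedDeriv_vacuumFun (n : ℕ) :
    ∃ q : ℂ[X], ∀ x, iteratedDeriv n vacuumFun x = q.eval (x : ℂ) * vacuumFun x := by
  induction n with
  | zero => exact ⟨1, by simp⟩
  | succ n ih =>
    obtain ⟨q, hq⟩ := ih
    refine ⟨q.derivative - Polynomial.X * q, fun x => ?_⟩
    rw [iteratedDeriv_succ, funext hq]
    have h1 : HasDerivAt (fun x : ℝ => q.eval (x : ℂ)) (q.derivative.eval (x : ℂ)) x :=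
      (q.hasDerivAt (x : ℂ)).comp_ofReal
    rw [(h1.fun_mul (hasDerivAt_vacuumFun x)).deriv]
    simp only [eval_sub, eval_mul, eval_X]
    ring

/-- The vacuum function as an element of the Schwartz class. -/
def vacuumSchwartz : 𝓢(ℝ, ℂ) where
  toFun := vacuumFun
  smooth' := by
    unfold vacuumFun
    have h : ContDiff ℝ ((⊤ : ℕ∞) : WithTop ℕ∞)
        fun x : ℝ => Real.pi ^ (-(1 / 4) : ℝ) * Real.exp (-(x ^ 2) / 2) := by fun_prop
    exact Complex.ofRealCLM.contDiff.comp h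
  decay' k n := by
    obtain ⟨q, hq⟩ := exists_iteratedDeriv_vacuumFun n
    obtain ⟨C, hC⟩ := exists_bound_polynomial_mul_gaussian (Polynomial.X ^ k * q)
    refine ⟨Real.pi ^ (-(1 / 4) : ℝ) * C, fun x => ?_⟩
    rw [norm_iteratedFDeriv_eq_norm_iteratedDeriv, hq]
    calc _ = Real.pi ^ (-(1 / 4) : ℝ) *
          (‖(Polynomial.X ^ k * q).eval (x : ℂ)‖ * Real.exp (-(x ^ 2) / 2)) := by
          simp only [vacuumFun, norm_mul, Polynomial.eval_mul, Polynomial.eval_pow,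
            Polynomial.eval_X, norm_pow, Complex.norm_real, Real.norm_eq_abs, Real.abs_exp]
          rw [abs_of_pos (by positivity : 0 < Real.pi ^ (-(1 / 4) : ℝ))]
          ring
      _ ≤ _ := by gcongr; exact hC x

theorem vacuumSchwartz_apply (x : ℝ) : vacuumSchwartz x = vacuumFun x := rfl

theorem schwartzEmbedding_coeFn (f : 𝓢(ℝ, ℂ)) : schwartzEmbedding f =ᵐ[volume] f :=
  f.coeFn_toLp 2 volume

theorem schwartzEmbedding_vacuumSchwartz : schwartzEmbedding vacuumSchwartz = vacuum := by
  apply Lp.ext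
  exact (schwartzEmbedding_coeFn _).trans (memLp_vacuumFun.coeFn_toLp).symm

theorem inner_schwartzEmbedding (f g : 𝓢(ℝ, ℂ)) :
    ⟪schwartzEmbedding f, schwartzEmbedding g⟫_ℂ = ∫ x, (starRingEnd ℂ) (f x) * g x := by
  refine (SchwartzMap.inner_toL2_toL2_eq f g volume).trans ?_
  simp only [RCLike.inner_apply, mul_comm]

theorem norm_vacuum : ‖vacuum‖ = 1 := by
  have h : ⟪vacuum, vacuum⟫_ℂ = 1 := by
    rw [← schwartzEmbedding_vacuumSchwartz, inner_schwartzEmbedding]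
    have h1 (x : ℝ) : (starRingEnd ℂ) (vacuumSchwartz x) * vacuumSchwartz x =
        ((Real.pi ^ (-(1 / 2) : ℝ) * Real.exp (-1 * x ^ 2) : ℝ) : ℂ) := by
      rw [vacuumSchwartz_apply, vacuumFun, Complex.conj_ofReal, ← Complex.ofReal_mul,
        mul_mul_mul_comm, ← Real.rpow_add Real.pi_pos, ← Real.exp_add,
        show -(1 / 4 : ℝ) + -(1 / 4) = -(1 / 2) by norm_num,
        show -(x ^ 2) / 2 + -(x ^ 2) / 2 = -1 * x ^ 2 by ring]
    simp only [h1]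
    rw [integral_complex_ofReal, integral_const_mul, integral_gaussian, div_one, Real.sqrt_eq_rpow,
      ← Real.rpow_add Real.pi_pos]
    norm_num
  have h2 : ‖vacuum‖ ^ 2 = 1 := by
    rw [← inner_self_eq_norm_sq (𝕜 := ℂ), h, RCLike.one_re]
  exact (pow_eq_one_iff_of_nonneg (norm_nonneg _) two_ne_zero).1 h2

/-- The canonical commutation relation. -/
theorem P_X (f : 𝓢(ℝ, ℂ)) : P (X f) = X (P f) - Complex.I • f := by
  ext x
  have h1 : HasDerivAt (fun x : ℝ => (x : ℂ) * f x) (1 * f x + x * deriv f x) x := by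
    refine HasDerivAt.mul ?_ (f.hasDerivAt x)
    simpa using (hasDerivAt_id x).ofReal_comp
  rw [sub_apply, smul_apply, X_apply, P_apply, P_apply,
    show (X f : ℝ → ℂ) = fun x : ℝ => (x : ℂ) * f x from funext (X_apply f), h1.deriv, smul_eq_mul]
  ring

/-- The operator `½ (X² + P²)` on Schwartz functions. -/
def oscillator : 𝓢(ℝ, ℂ) →ₗ[ℂ] 𝓢(ℝ, ℂ) := (1 / 2 : ℂ) • (X ∘ₗ X + P ∘ₗ P)

/-- The creation operator `X - iP`, without the usual factor `1/√2`. -/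
def creation : 𝓢(ℝ, ℂ) →ₗ[ℂ] 𝓢(ℝ, ℂ) := X - Complex.I • P

/-- The annihilation operator `X + iP`, without the usual factor `1/√2`. -/
def annihilation : 𝓢(ℝ, ℂ) →ₗ[ℂ] 𝓢(ℝ, ℂ) := X + Complex.I • P

theorem oscillator_apply (f : 𝓢(ℝ, ℂ)) :
    oscillator f = (1 / 2 : ℂ) • (X (X f) + P (P f)) := rfl

theorem creation_apply (f : 𝓢(ℝ, ℂ)) : creation f = X f - Complex.I • P f := rfl

theorem annihilation_apply (f : 𝓢(ℝ, ℂ)) : annihilation f = X f + Complex.I • P f := rfl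

theorem annihilation_creation (f : 𝓢(ℝ, ℂ)) :
    annihilation (creation f) = (2 : ℂ) • oscillator f + f := by
  simp only [annihilation_apply, creation_apply, oscillator_apply, map_sub, map_smul, P_X, smul_sub,
    smul_add, smul_smul, Complex.I_mul_I]
  module

theorem creation_annihilation (f : 𝓢(ℝ, ℂ)) :
    creation (annihilation f) = (2 : ℂ) • oscillator f - f := by
  simp only [annihilation_apply, creation_apply, oscillator_apply, map_add, map_smul, P_X, smul_sub,
    smul_add, smul_smul, Complex.I_mul_I]
  module

/-- The creation operator raises the energy by one. -/
theorem oscillator_creation (f : 𝓢(ℝ, ℂ)) :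
    oscillator (creation f) = creation (oscillator f) + creation f := by
  have h1 := creation_annihilation (creation f)
  rw [annihilation_creation, map_add, map_smul] at h1
  have h2 : (2 : ℂ) • oscillator (creation f) =
      (2 : ℂ) • (creation (oscillator f) + creation f) := by
    rw [eq_sub_iff_add_eq.1 h1 |>.symm]
    module
  exact smul_right_injective _ (two_ne_zero) h2

theorem annihilation_vacuumSchwartz : annihilation vacuumSchwartz = 0 := by
  ext x
  rw [annihilation_apply, add_apply, smul_apply, X_apply, P_apply,
    show (vacuumSchwartz : ℝ → ℂ) = vacuumFun from rfl, (hasDerivAt_vacuumFun x).deriv, smul_eq_mul]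
  rw [zero_apply]
  linear_combination (x * vacuumFun x) * Complex.I_mul_I

/-- The unnormalized Hermite functions, generated from the vacuum by the creation operator. -/
def hermiteFun (n : ℕ) : 𝓢(ℝ, ℂ) := creation^[n] vacuumSchwartz

theorem hermiteFun_zero : hermiteFun 0 = vacuumSchwartz := rfl

theorem hermiteFun_succ (n : ℕ) : hermiteFun (n + 1) = creation (hermiteFun n) :=
  Function.iterate_succ_apply' _ _ _

theorem oscillator_hermiteFun (n : ℕ) :
    oscillator (hermiteFun n) = (((n : ℝ) + 1 / 2 : ℝ) : ℂ) • hermiteFun n := by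
  induction n with
  | zero =>
    have h := creation_annihilation vacuumSchwartz
    rw [annihilation_vacuumSchwartz, map_zero, eq_comm, sub_eq_zero] at h
    have h2 : (2 : ℂ) • oscillator (hermiteFun 0) =
        (2 : ℂ) • ((((0 : ℕ) : ℝ) + 1 / 2 : ℝ) : ℂ) • hermiteFun 0 := by
      rw [hermiteFun_zero, h, smul_smul]
      norm_num
    exact smul_right_injective _ (two_ne_zero) h2
  | succ n ih =>
    rw [hermiteFun_succ, oscillator_creation, ih, map_smul]
    push_cast
    module

theorem annihilation_hermiteFun_succ (n : ℕ) :
    annihilation (hermiteFun (n + 1)) = (2 * ((n : ℂ) + 1)) • hermiteFun n := by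
  rw [hermiteFun_succ, annihilation_creation, oscillator_hermiteFun]
  push_cast
  module

/-- The Hermite functions do not vanish, since the annihilation operator leads back from each of
them to a nonzero multiple of the preceding one. -/
theorem hermiteFun_ne_zero (n : ℕ) : hermiteFun n ≠ 0 := by
  induction n with
  | zero =>
    intro h
    have h1 := norm_vacuum
    rw [← schwartzEmbedding_vacuumSchwartz, ← hermiteFun_zero, h, map_zero, norm_zero] at h1
    exact zero_ne_one h1
  | succ n ih =>
    intro h
    have h1 := annihilation_hermiteFun_succ n
    rw [h, map_zero, eq_comm, smul_eq_zero] at h1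
    refine h1.elim (fun h2 => ?_) ih
    norm_cast at h2

theorem X_eq (f : 𝓢(ℝ, ℂ)) : X f = (1 / 2 : ℂ) • (annihilation f + creation f) := by
  rw [annihilation_apply, creation_apply]
  module

/-- Every `x ^ k e^{-x²/2}` is a combination of Hermite functions, because their span is stable
under `X`, a multiple of the sum of the annihilation and creation operators. -/
theorem X_iterate_vacuum_mem_span (k : ℕ) :
    X^[k] vacuumSchwartz ∈ Submodule.span ℂ (Set.range hermiteFun) := by
  induction k with
  | zero => exact Submodule.subset_span ⟨0, rfl⟩
  | succ k ih =>
    rw [Function.iterate_succ_apply']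
    have h : Submodule.span ℂ (Set.range hermiteFun) ≤
        (Submodule.span ℂ (Set.range hermiteFun)).comap X := by
      rw [Submodule.span_le]
      rintro _ ⟨n, rfl⟩
      rw [SetLike.mem_coe, Submodule.mem_comap, X_eq, ← hermiteFun_succ]
      refine Submodule.smul_mem _ _ (Submodule.add_mem _ ?_ (Submodule.subset_span ⟨_, rfl⟩))
      cases n with
      | zero => rw [hermiteFun_zero, annihilation_vacuumSchwartz]; exact Submodule.zero_mem _
      | succ n =>
        rw [annihilation_hermiteFun_succ]
        exact Submodule.smul_mem _ _ (Submodule.subset_span ⟨_, rfl⟩)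
    exact h ih

theorem inner_X (f g : 𝓢(ℝ, ℂ)) :
    ⟪schwartzEmbedding f, schwartzEmbedding (X g)⟫_ℂ =
      ⟪schwartzEmbedding (X f), schwartzEmbedding g⟫_ℂ := by
  rw [inner_schwartzEmbedding, inner_schwartzEmbedding]
  congr 1 with x
  rw [X_apply, X_apply, map_mul, Complex.conj_ofReal]
  ring

theorem inner_P (f g : 𝓢(ℝ, ℂ)) :
    ⟪schwartzEmbedding f, schwartzEmbedding (P g)⟫_ℂ =
      ⟪schwartzEmbedding (P f), schwartzEmbedding g⟫_ℂ := by
  rw [inner_schwartzEmbedding, inner_schwartzEmbedding]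
  have h := SchwartzMap.integral_bilinear_deriv_right_eq_neg_left f g
    ((ContinuousLinearMap.mul ℝ ℂ).comp (Complex.conjCLE : ℂ →L[ℝ] ℂ))
  simp only [ContinuousLinearMap.comp_apply, ContinuousLinearMap.mul_apply',
    ContinuousLinearEquiv.coe_coe, Complex.conjCLE_apply] at h
  simp only [P_apply, map_mul, map_neg, Complex.conj_I, neg_neg]
  calc ∫ x, (starRingEnd ℂ) (f x) * (-Complex.I * deriv g x)
      = -Complex.I * ∫ x, (starRingEnd ℂ) (f x) * deriv g x := by
        rw [← integral_const_mul]
        congr 1 with x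
        ring
    _ = Complex.I * ∫ x, (starRingEnd ℂ) (deriv f x) * g x := by rw [h]; ring
    _ = _ := by
        rw [← integral_const_mul]
        congr 1 with x
        ring

theorem inner_oscillator (f g : 𝓢(ℝ, ℂ)) :
    ⟪schwartzEmbedding f, schwartzEmbedding (oscillator g)⟫_ℂ =
      ⟪schwartzEmbedding (oscillator f), schwartzEmbedding g⟫_ℂ := by
  simp only [oscillator_apply, map_smul, map_add, inner_smul_left, inner_smul_right, inner_add_left,
    inner_add_right, inner_X, inner_P]
  rw [map_div₀, map_one, Complex.conj_ofNat]

theorem mem_graph_hamiltonian_iff (u v : L2) : (u, v) ∈ hamiltonian.graph ↔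
    ∃ f : 𝓢(ℝ, ℂ), schwartzEmbedding f = u ∧ schwartzEmbedding (oscillator f) = v := by
  rw [LinearPMap.mem_graph_iff]
  have key (f : 𝓢(ℝ, ℂ)) (h : schwartzEmbedding f ∈ hamiltonian.domain) :
      hamiltonian ⟨schwartzEmbedding f, h⟩ = schwartzEmbedding (oscillator f) := by
    change schwartzEmbedding (oscillator ((LinearEquiv.ofInjective schwartzEmbedding
      schwartzEmbedding_injective).symm ⟨schwartzEmbedding f, h⟩)) = _
    congr 2
    rw [LinearEquiv.symm_apply_eq]
    rfl
  constructor
  · rintro ⟨⟨_, f, rfl⟩, h1, h2⟩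
    exact ⟨f, h1, (key f _).symm.trans h2⟩
  · rintro ⟨f, rfl, rfl⟩
    exact ⟨⟨_, f, rfl⟩, rfl, key f _⟩

end Schwartz

/-! ### Completeness of the Hermite functions -/

section Completeness

open scoped FourierTransform ContDiff

theorem X_iterate_apply (k : ℕ) (f : 𝓢(ℝ, ℂ)) (x : ℝ) : X^[k] f x = (x : ℂ) ^ k * f x := by
  induction k with
  | zero => simp
  | succ k ih => rw [Function.iterate_succ_apply', X_apply, ih, pow_succ']; ring

theorem norm_vacuumFun (x : ℝ) :
    ‖vacuumFun x‖ = Real.pi ^ (-(1 / 4) : ℝ) * Real.exp (-(x ^ 2) / 2) := by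
  rw [vacuumFun, Complex.norm_real, Real.norm_of_nonneg (by positivity)]

theorem continuous_vacuumFun : Continuous vacuumFun := vacuumSchwartz.continuous

theorem memLp_exp_mul_vacuumFun (a : ℝ) :
    MemLp (fun x : ℝ => (Real.exp (a * |x|) : ℂ) * vacuumFun x) 2 volume := by
  have hc : Continuous fun x : ℝ => (Real.exp (a * |x|) : ℂ) * vacuumFun x :=
    Continuous.mul (by fun_prop) continuous_vacuumFun
  rw [memLp_two_iff_integrable_sq_norm hc.aestronglyMeasurable]
  refine ((integrable_exp_neg_mul_sq (b := 1 / 2) (by norm_num)).const_mul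
    ((Real.pi ^ (-(1 / 4) : ℝ)) ^ 2 * Real.exp (2 * a ^ 2))).mono'
    (hc.norm.pow 2).aestronglyMeasurable (ae_of_all _ fun x => ?_)
  rw [Real.norm_of_nonneg (by positivity), norm_mul, norm_vacuumFun, Complex.norm_real,
    Real.norm_eq_abs, Real.abs_exp]
  calc _ = (Real.pi ^ (-(1 / 4) : ℝ)) ^ 2 *
        (Real.exp (a * |x|) * Real.exp (-(x ^ 2) / 2)) ^ 2 := by ring
    _ ≤ (Real.pi ^ (-(1 / 4) : ℝ)) ^ 2 *
        (Real.exp (2 * a ^ 2) * Real.exp (-(1 / 2) * x ^ 2)) := by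
        rw [← Real.exp_add, ← Real.exp_add, ← Real.exp_nat_mul]
        gcongr
        push_cast
        nlinarith [sq_nonneg (2 * a - |x|), sq_abs x]
    _ = _ := by ring

/-- An integrable function with vanishing Fourier transform is zero almost everywhere. -/
theorem ae_eq_zero_of_fourier_eq_zero {g : ℝ → ℂ} (hg : Integrable g) (h : ∀ w, 𝓕 g w = 0) :
    g =ᵐ[volume] 0 := by
  refine ae_eq_zero_of_integral_contDiff_smul_eq_zero hg.locallyIntegrable fun ψ hψ hψc => ?_
  have hψc' : HasCompactSupport fun x => (ψ x : ℂ) := hψc.comp_left Complex.ofReal_zero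
  let ψ' : 𝓢(ℝ, ℂ) := hψc'.toSchwartzMap (Complex.ofRealCLM.contDiff.comp hψ)
  let φ : 𝓢(ℝ, ℂ) := 𝓕⁻ ψ'
  have hφ : 𝓕 (φ : ℝ → ℂ) = fun x => (ψ x : ℂ) := by
    rw [← SchwartzMap.fourier_coe, FourierTransform.fourier_fourierInv_eq]
    rfl
  have key : ∫ ξ, 𝓕 (φ : ℝ → ℂ) ξ • g ξ = ∫ x, φ x • 𝓕 g x := by
    simpa using! VectorFourier.integral_fourierIntegral_smul_eq_flip (L := innerₗ ℝ)
      Real.continuous_fourierChar continuous_inner φ.integrable hg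
  simp only [h, smul_zero, integral_zero, hφ] at key
  simpa using key

/-- Termwise integration of the exponential series against a function with vanishing moments. -/
theorem integral_cexp_mul_eq_zero_of_moments {g : ℝ → ℂ} (hg : AEStronglyMeasurable g volume)
    (hint : ∀ a : ℝ, Integrable fun x => Real.exp (a * |x|) * ‖g x‖)
    (hmom : ∀ k : ℕ, ∫ x : ℝ, (x : ℂ) ^ k * g x = 0) (t : ℝ) :
    ∫ x : ℝ, Complex.exp (Complex.I * t * x) * g x = 0 := by
  have hexp (x : ℝ) : HasSum (fun k : ℕ => (|t| * |x|) ^ k / k.factorial * ‖g x‖)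
      (Real.exp (|t| * |x|) * ‖g x‖) := by
    rw [Real.exp_eq_exp_ℝ]
    exact (NormedSpace.expSeries_div_hasSum_exp (|t| * |x|)).mul_right _
  have hcexp (x : ℝ) : HasSum (fun k : ℕ => (Complex.I * t * x) ^ k / k.factorial * g x)
      (Complex.exp (Complex.I * t * x) * g x) := by
    rw [Complex.exp_eq_exp_ℂ]
    exact (NormedSpace.expSeries_div_hasSum_exp (Complex.I * t * x)).mul_right _
  have hmeas (k : ℕ) : AEStronglyMeasurable
      (fun x : ℝ => (Complex.I * t * x) ^ k / k.factorial * g x) volume :=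
    AEStronglyMeasurable.mul (Continuous.aestronglyMeasurable (by fun_prop)) hg
  have hbound (k : ℕ) (x : ℝ) : ‖(Complex.I * t * x) ^ k / k.factorial * g x‖ ≤
      (|t| * |x|) ^ k / k.factorial * ‖g x‖ := by
    simp
  have htsum : Integrable fun x : ℝ => ∑' k : ℕ, (|t| * |x|) ^ k / k.factorial * ‖g x‖ := by
    simp only [fun x => (hexp x).tsum_eq]
    exact hint |t|
  have hsum := hasSum_integral_of_dominated_convergence _ hmeas
    (fun k => ae_of_all _ (hbound k)) (ae_of_all _ fun x => (hexp x).summable) htsum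
    (ae_of_all _ hcexp)
  have hzero (k : ℕ) : ∫ x : ℝ, (Complex.I * t * x) ^ k / k.factorial * g x = 0 := by
    calc _ = ∫ x : ℝ, (Complex.I * t) ^ k / k.factorial * ((x : ℂ) ^ k * g x) := by
          congr 1 with x
          ring
      _ = 0 := by rw [integral_const_mul, hmom, mul_zero]
  simp only [hzero] at hsum
  exact hsum.unique hasSum_zero

/-- A function with exponential decay is determined by its moments: the power series of its
Fourier transform has the moments as coefficients. -/
theorem ae_eq_zero_of_moments_eq_zero {g : ℝ → ℂ} (hg : AEStronglyMeasurable g volume)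
    (hint : ∀ a : ℝ, Integrable fun x => Real.exp (a * |x|) * ‖g x‖)
    (hmom : ∀ k : ℕ, ∫ x : ℝ, (x : ℂ) ^ k * g x = 0) : g =ᵐ[volume] 0 := by
  have hgi : Integrable g := by
    have h := hint 0
    simp only [zero_mul, Real.exp_zero, one_mul] at h
    exact (integrable_norm_iff hg).1 h
  refine ae_eq_zero_of_fourier_eq_zero hgi fun w => ?_
  rw [Real.fourier_real_eq_integral_exp_smul,
    ← integral_cexp_mul_eq_zero_of_moments hg hint hmom (-2 * Real.pi * w)]
  congr 1 with x
  rw [smul_eq_mul]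
  congr 2
  push_cast
  ring

/-- The functions `x ^ k Φ` are total in `L²(ℝ, ℂ)`. -/
theorem eq_zero_of_inner_X_iterate_vacuum (u : L2)
    (hu : ∀ k, ⟪schwartzEmbedding (X^[k] vacuumSchwartz), u⟫_ℂ = 0) : u = 0 := by
  have hum : AEStronglyMeasurable u volume := Lp.aestronglyMeasurable u
  have hgm : AEStronglyMeasurable (fun x => vacuumFun x * u x) volume :=
    continuous_vacuumFun.aestronglyMeasurable.mul hum
  have hint (a : ℝ) : Integrable (fun x => Real.exp (a * |x|) * ‖vacuumFun x * u x‖) := by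
    refine ((memLp_exp_mul_vacuumFun a).integrable_mul (Lp.memLp u)).norm.congr
      (ae_of_all _ fun x => ?_)
    simp only [Pi.mul_apply, norm_mul, Complex.norm_real, Real.norm_eq_abs, Real.abs_exp]
    ring
  have hmom (k : ℕ) : ∫ x : ℝ, (x : ℂ) ^ k * (vacuumFun x * u x) = 0 := by
    rw [← hu k, L2.inner_def]
    refine integral_congr_ae ?_
    filter_upwards [schwartzEmbedding_coeFn (X^[k] vacuumSchwartz)] with x hx
    rw [hx, X_iterate_apply, RCLike.inner_apply, vacuumSchwartz_apply, vacuumFun, map_mul,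
      map_pow, Complex.conj_ofReal, Complex.conj_ofReal]
    ring
  rw [Lp.eq_zero_iff_ae_eq_zero]
  filter_upwards [ae_eq_zero_of_moments_eq_zero hgm hint hmom] with x hx
  refine (mul_eq_zero.1 hx).resolve_left fun h => ?_
  have h1 := norm_vacuumFun x
  rw [h, norm_zero] at h1
  have : 0 < Real.pi ^ (-(1 / 4) : ℝ) * Real.exp (-(x ^ 2) / 2) := by positivity
  exact this.ne h1

/-- The normalized Hermite functions. -/
def normalizedHermite (n : ℕ) : L2 :=
  ((‖schwartzEmbedding (hermiteFun n)‖⁻¹ : ℝ) : ℂ) • schwartzEmbedding (hermiteFun n)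

/-- Hermite functions are orthogonal, being eigenfunctions of a symmetric operator with distinct
eigenvalues. -/
theorem inner_hermiteFun_of_ne {m n : ℕ} (h : m ≠ n) :
    ⟪schwartzEmbedding (hermiteFun m), schwartzEmbedding (hermiteFun n)⟫_ℂ = 0 := by
  have h1 := inner_oscillator (hermiteFun m) (hermiteFun n)
  rw [oscillator_hermiteFun, oscillator_hermiteFun, map_smul, map_smul, inner_smul_left,
    inner_smul_right, Complex.conj_ofReal] at h1
  rw [← sub_eq_zero, ← sub_mul, mul_eq_zero] at h1
  refine h1.resolve_left fun h2 => h ?_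
  rw [sub_eq_zero, Complex.ofReal_inj, add_left_inj] at h2
  exact_mod_cast h2.symm

theorem norm_schwartzEmbedding_hermiteFun_ne_zero (n : ℕ) :
    ‖schwartzEmbedding (hermiteFun n)‖ ≠ 0 := by
  rw [norm_ne_zero_iff, ← map_zero schwartzEmbedding]
  exact schwartzEmbedding_injective.ne (hermiteFun_ne_zero n)

theorem orthonormal_normalizedHermite : Orthonormal ℂ normalizedHermite := by
  refine ⟨fun n => ?_, fun m n h => ?_⟩
  · rw [normalizedHermite, norm_smul, Complex.norm_real, norm_inv, norm_norm,
      inv_mul_cancel₀ (norm_schwartzEmbedding_hermiteFun_ne_zero n)]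
  · simp only [normalizedHermite]
    rw [inner_smul_left, inner_smul_right, inner_hermiteFun_of_ne h,
      mul_zero, mul_zero]

theorem span_normalizedHermite_orthogonal :
    (Submodule.span ℂ (Set.range normalizedHermite))ᗮ = ⊥ := by
  rw [Submodule.eq_bot_iff]
  intro u hu
  rw [Submodule.mem_orthogonal] at hu
  have h1 (n : ℕ) : ⟪schwartzEmbedding (hermiteFun n), u⟫_ℂ = 0 := by
    have h2 := hu _ (Submodule.subset_span ⟨n, rfl⟩)
    rw [normalizedHermite, inner_smul_left, Complex.conj_ofReal, mul_eq_zero] at h2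
    refine h2.resolve_left ?_
    exact Complex.ofReal_ne_zero.2 (inv_ne_zero (norm_schwartzEmbedding_hermiteFun_ne_zero n))
  refine eq_zero_of_inner_X_iterate_vacuum u fun k => ?_
  refine Submodule.span_induction (p := fun f _ => ⟪schwartzEmbedding f, u⟫_ℂ = 0) ?_ ?_ ?_ ?_
    (X_iterate_vacuum_mem_span k)
  · rintro _ ⟨n, rfl⟩
    exact h1 n
  · rw [map_zero, inner_zero_left]
  · intro f g _ _ hf hg
    rw [map_add, inner_add_left, hf, hg, add_zero]
  · intro a f _ hf
    rw [map_smul, inner_smul_left, hf, mul_zero]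

/-- The Hilbert basis of `L²(ℝ, ℂ)` consisting of the normalized Hermite functions. -/
def hermiteBasis : HilbertBasis ℕ ℂ L2 :=
  HilbertBasis.mkOfOrthogonalEqBot orthonormal_normalizedHermite span_normalizedHermite_orthogonal

theorem hermiteBasis_apply (n : ℕ) : hermiteBasis n = normalizedHermite n := by
  rw [hermiteBasis, HilbertBasis.coe_mkOfOrthogonalEqBot]

theorem hermiteBasis_mem_graph (n : ℕ) :
    (hermiteBasis n, (((n : ℝ) + 1 / 2 : ℝ) : ℂ) • hermiteBasis n) ∈ hamiltonian.graph := by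
  have h : (schwartzEmbedding (hermiteFun n),
      (((n : ℝ) + 1 / 2 : ℝ) : ℂ) • schwartzEmbedding (hermiteFun n)) ∈ hamiltonian.graph :=
    (mem_graph_hamiltonian_iff _ _).2 ⟨_, rfl, by rw [oscillator_hermiteFun, map_smul]⟩
  have h1 := hamiltonian.graph.smul_mem
    ((‖schwartzEmbedding (hermiteFun n)‖⁻¹ : ℝ) : ℂ) h
  rw [Prod.smul_mk, smul_comm] at h1
  rwa [hermiteBasis_apply]

theorem vacuum_mem_graph : (vacuum, ((1 / 2 : ℝ) : ℂ) • vacuum) ∈ hamiltonian.graph := by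
  refine (mem_graph_hamiltonian_iff _ _).2 ⟨_, schwartzEmbedding_vacuumSchwartz, ?_⟩
  rw [← hermiteFun_zero, oscillator_hermiteFun, map_smul, hermiteFun_zero,
    schwartzEmbedding_vacuumSchwartz]
  norm_num

theorem hamiltonian_le_of_isDiagonal {T : L2 →ₗ.[ℂ] L2}
    (hT : IsDiagonal hermiteBasis (fun n => (n : ℝ) + 1 / 2) T) : hamiltonian ≤ T := by
  apply LinearPMap.le_of_le_graph
  rintro ⟨u, v⟩ huv
  obtain ⟨f, rfl, rfl⟩ := (mem_graph_hamiltonian_iff u v).1 huv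
  refine (hT _ _).2 fun n => ?_
  obtain ⟨k, hk, hk'⟩ := (mem_graph_hamiltonian_iff _ _).1 (hermiteBasis_mem_graph n)
  rw [← hk, inner_oscillator, hk', hk, inner_smul_left, Complex.conj_ofReal]

end Completeness

end HarmonicOscillator

end

open HarmonicOscillator in
theorem theorem3p3 :
    -- the Hamiltonian, defined on the Schwartz class, has a self-adjoint extension
    (∃ T : HarmonicOscillator.L2 →ₗ.[ℂ] HarmonicOscillator.L2,
      IsSelfAdjoint T ∧ HarmonicOscillator.hamiltonian ≤ T) ∧
    ∀ T : HarmonicOscillator.L2 →ₗ.[ℂ] HarmonicOscillator.L2,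
      IsSelfAdjoint T → HarmonicOscillator.hamiltonian ≤ T →
      -- the spectral resolution of `T` and the unitary group `e^{itT}` exist
      (∃ E : HarmonicOscillator.ResolutionOfIdentity HarmonicOscillator.L2,
        E.IsSpectralResolution T) ∧
      (∃ U : ℝ → HarmonicOscillator.L2 →L[ℂ] HarmonicOscillator.L2,
        HarmonicOscillator.IsUnitaryExponential T U) ∧
      -- vacuum spectral resolution, vacuum distribution and its characteristic function
      (∀ E : HarmonicOscillator.ResolutionOfIdentity HarmonicOscillator.L2,
        E.IsSpectralResolution T →
        (∀ r : ℝ, ⟪HarmonicOscillator.vacuum, E.proj r HarmonicOscillator.vacuum⟫_ℂ =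
          (HarmonicOscillator.heaviside (1 / 2) r : ℂ)) ∧
        E.measure HarmonicOscillator.vacuum = Measure.dirac (1 / 2 : ℝ) ∧
        ∀ t : ℝ, ∫ r : ℝ, Complex.exp (Complex.I * t * r) ∂(E.measure HarmonicOscillator.vacuum) =
          Complex.exp (Complex.I * t / 2)) ∧
      -- vacuum characteristic function `⟨Φ, e^{itT} Φ⟩`
      (∀ U : ℝ → HarmonicOscillator.L2 →L[ℂ] HarmonicOscillator.L2,
        HarmonicOscillator.IsUnitaryExponential T U →
        ∀ t : ℝ, ⟪HarmonicOscillator.vacuum, U t HarmonicOscillator.vacuum⟫_ℂ =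
          Complex.exp (Complex.I * t / 2)) := by
  obtain ⟨T₀, hT₀, hT₀'⟩ := exists_isDiagonal hermiteBasis fun n => (n : ℝ) + 1 / 2
  refine ⟨⟨T₀, hT₀, hamiltonian_le_of_isDiagonal hT₀'⟩, fun T hT hle => ?_⟩
  have hgraph := LinearPMap.le_graph_of_le hle
  have hdiag := isDiagonal_of_isSelfAdjoint hermiteBasis (fun n => (n : ℝ) + 1 / 2) hT fun n =>
    hgraph (hermiteBasis_mem_graph n)
  have hvac := hgraph vacuum_mem_graph
  refine ⟨exists_isSpectralResolution_of_isDiagonal hdiag,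
    exists_isUnitaryExponential_of_isDiagonal hdiag, fun E hE => ?_, fun U hU t => ?_⟩
  · have hμ : E.measure vacuum = Measure.dirac (1 / 2 : ℝ) := by
      rw [measure_eq_smul_dirac_of_eigenvector hT hE hvac, norm_vacuum, one_pow,
        ENNReal.ofReal_one, one_smul]
    refine ⟨fun r => ?_, hμ, fun t => ?_⟩
    · have h := E.measure_Iic vacuum r
      rw [hμ, Measure.dirac_apply' _ measurableSet_Iic] at h
      have h2 := congrArg ENNReal.toReal h
      rw [ENNReal.toReal_ofReal (by positivity)] at h2
      rw [E.inner_proj, ← h2, heaviside]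
      by_cases hr : 1 / 2 ≤ r
      · rw [if_pos hr, Set.indicator_of_mem (Set.mem_Iic.2 hr), Pi.one_apply, ENNReal.toReal_one]
      · rw [if_neg hr, Set.indicator_of_notMem (by simpa using hr), ENNReal.toReal_zero]
    · rw [hμ, integral_dirac]
      push_cast
      ring_nf
  · rw [hU.apply_eigenvector hvac, inner_smul_right, inner_self_eq_norm_sq_to_K, norm_vacuum]
    push_cast
    ring_nf
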